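/- Let $n,k\ge 0$ be integers, let $U\subset\mathbb R^n$ be open, and let $\omega$ be a differential $k$-form on $U$, that is, an arbitrary function $\omega:U\to\Lambda^k(\mathbb R^n)^*$. **Definitions.** For $m\ge 1$, an $m$-block is a product $B=\prod_{i=1}^m[a_{i0},a_{i1}]\subset\mathbb R^m$ with $a_{i0}<a_{i1}$ for all $i$; the $0$-block is the one-point space $\mathbb R^0$. A singular $m$-block of class $C^1$ in $U$ is a map $c:B\to U$ on an $m$-block $B$ which near each point of $B$ is the restriction of an $\mathbb R^n$-valued $C^1$ map defined on an open subset of $\mathbb R^m$. An $m$-chain of class $C^1$ in $U$ is a formal finite sum $n_1c_1+\dots+n_lc_l$ of such singular $m$-blocks with $n_i\in\mathbb Z$. For $m\ge1$ the boundary of a singular $m$-block $c$ is the $(m-1)$-chain $$\partial c=\sum_{i=1}^{m}\sum_{j=0}^{1}(-1)^{i+j}c_{ij},\qquad c_{ij}(t_1,\dots,\widehat{t_i},\dots,t_m)=c(t_1,\dots,a_{ij},\dots,t_m),$$ and $\partial(n_1c_1+\dots+n_lc_l)=n_1\partial c_1+\dots+n_l\partial c_l$. For a singular $m$-block $c:B\to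 U$ and an $m$-form $\eta$, write $c^*\eta=f\,\mathrm dx^1\wedge\dots\wedge\mathrm dx^m$ and put $\int_c\eta=\int_Bf$ (Riemann integral) when this exists; for $m=0$ this is the value of $\eta$ at the point $c$. If $\eta$ is given only on $c(\mathring B)$, then $\int_c\eta$ is the Riemann integral over $B$ of an extension of $f|_{\mathring B}$ to $B$, when there is a Riemann integrable one (its integral does not depend on the extension). For chains, $\int_{n_1c_1+\dots+n_lc_l}\eta=\sum_i n_i\int_{c_i}\eta$ when all the integrals on the right exist. Where $\omega$ is differentiable, $$\mathrm d\omega_x(v_1,\dots,v_{k+1})=\sum_{i=1}^{k+1}(-1)^{i+1}\,(\omega'(x)v_i)(v_1,\dots,\widehat{v_i},\dots,v_{k+1}).$$ **Theorem (Stokes without $C^1$ assumption).** Let $c:B\to U$ be a singular $(k+1)$-block of class $C^1$. If the restriction of $\omega$ to $c(B)$ is continuous and $\omega$ is differentiable at every point of $c(\mathring B)$, then, whenever $\int_c\mathrm d\omega$ exists, $\int_{\partial c}\omega$ exists and $$\int_{\partial c}\omega=\int_c\mathrm d\omega.$$ More generally, let $c=n_1c_1+\dots+n_lc_l$ be a $(k+1)$-chain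 of class $C^1$ with $c_i:B_i\to U$ distinct and $n_i\neq0$. If for each $i$ the restriction of $\omega$ to $c_i(B_i)$ is continuous and $\omega$ is differentiable at every point of $c_i(\mathring B_i)$, then the same conclusion holds for $c$. -/

import Mathlib

open scoped BigOperators

noncomputable section

namespace Stokes

/-- Class `C¹` for a function on an arbitrary subset `X` of a normed space: near each point of `X`
the function is the restriction of a `C¹` function defined on an open neighbourhood. -/
def IsC1On {E F : Type*} [NormedAddCommGroup E] [NormedSpace ℝ E] [NormedAddCommGroup F]
    [NormedSpace ℝ F] (f : E → F) (X : Set E) : Prop :=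
  ∀ x ∈ X, ∃ V : Set E, IsOpen V ∧ x ∈ V ∧
    ∃ G : E → F, ContDiffOn ℝ 1 G V ∧ ∀ y ∈ V ∩ X, f y = G y

/-- A differential `m`-form on (a subset of) `ℝⁿ`, without any regularity. For a form on an open
set `U` only the values on `U` matter. -/
abbrev Form (n m : ℕ) : Type :=
  EuclideanSpace ℝ (Fin n) → EuclideanSpace ℝ (Fin n) [⋀^Fin m]→L[ℝ] ℝ

/-- A singular `k`-block of class `C¹` in `U ⊆ ℝⁿ`: a nondegenerate closed block
`box.Icc = ∏ i, [box.lower i, box.upper i]` and a `C¹` map from it to `U`. The map is stored as a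
total function with value `0` off the block, so that a singular block is determined by its block
and by its values there. For `k = 0` the block is the one-point space. -/
structure SingularBlock {n : ℕ} (k : ℕ) (U : Set (EuclideanSpace ℝ (Fin n))) where
  box : BoxIntegral.Box (Fin k)
  toFun : (Fin k → ℝ) → EuclideanSpace ℝ (Fin n)
  mapsTo : Set.MapsTo toFun (BoxIntegral.Box.Icc box) U
  isC1On : IsC1On toFun (BoxIntegral.Box.Icc box)
  eq_zero : ∀ t, t ∉ BoxIntegral.Box.Icc box → toFun t = 0

/-- `k`-chains of class `C¹` in `U`: formal finite sums of singular `k`-blocks with integer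
coefficients. -/
abbrev Chain {n : ℕ} (k : ℕ) (U : Set (EuclideanSpace ℝ (Fin n))) : Type :=
  SingularBlock k U →₀ ℤ

variable {n k : ℕ} {U : Set (EuclideanSpace ℝ (Fin n))}

/-- The image `c(B)` of the closed block. -/
def SingularBlock.image (c : SingularBlock k U) : Set (EuclideanSpace ℝ (Fin n)) :=
  c.toFun '' BoxIntegral.Box.Icc c.box

/-- The image under `c` of the interior of the block. -/
def SingularBlock.interiorImage (c : SingularBlock k U) : Set (EuclideanSpace ℝ (Fin n)) :=
  c.toFun '' BoxIntegral.Box.Ioo c.box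

/-- The `i`-th coordinate of the lower (`j = 0`) or upper (`j = 1`) face of a block. -/
def endpoint (I : BoxIntegral.Box (Fin (k + 1))) (i : Fin (k + 1)) (j : Fin 2) : ℝ :=
  if j = 0 then I.lower i else I.upper i

theorem endpoint_mem (I : BoxIntegral.Box (Fin (k + 1))) (i : Fin (k + 1)) (j : Fin 2) :
    endpoint I i j ∈ Set.Icc (I.lower i) (I.upper i) := by
  unfold endpoint
  split_ifs
  · exact Set.left_mem_Icc.2 (I.lower_le_upper i)
  · exact Set.right_mem_Icc.2 (I.lower_le_upper i)

theorem insertNth_mem_Icc_iff (I : BoxIntegral.Box (Fin (k + 1))) (i : Fin (k + 1)) (j : Fin 2)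
    (t : Fin k → ℝ) :
    (i.insertNth (endpoint I i j) t : Fin (k + 1) → ℝ) ∈ BoxIntegral.Box.Icc I ↔
      t ∈ BoxIntegral.Box.Icc (I.face i) := by
  have h := endpoint_mem I i j
  simp only [BoxIntegral.Box.Icc_def, Set.mem_Icc, Fin.insertNth_le_iff, Fin.le_insertNth_iff]
  constructor
  · rintro ⟨⟨_, h1⟩, _, h2⟩
    exact ⟨h1, h2⟩
  · rintro ⟨h1, h2⟩
    exact ⟨⟨h.1, h1⟩, h.2, h2⟩

theorem contDiff_insertNth (i : Fin (k + 1)) (a : ℝ) :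
    ContDiff ℝ 1 (fun t : Fin k → ℝ => (i.insertNth a t : Fin (k + 1) → ℝ)) := by
  rw [contDiff_pi]
  intro l
  refine Fin.succAboveCases i ?_ (fun l => ?_) l
  · simpa using contDiff_const
  · simpa using contDiff_apply ℝ ℝ l

/-- The face `c_{ij}` of a singular block: the `i`-th variable is fixed at its lower (`j = 0`) or
upper (`j = 1`) endpoint. -/
def SingularBlock.face (c : SingularBlock (k + 1) U) (i : Fin (k + 1)) (j : Fin 2) :
    SingularBlock k U where
  box := c.box.face i
  toFun t := c.toFun (i.insertNth (endpoint c.box i j) t)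
  mapsTo t ht := c.mapsTo ((insertNth_mem_Icc_iff c.box i j t).2 ht)
  isC1On := by
    intro t ht
    obtain ⟨V, hV, htV, G, hG, hfG⟩ := c.isC1On _ ((insertNth_mem_Icc_iff c.box i j t).2 ht)
    have hι := contDiff_insertNth i (endpoint c.box i j)
    refine ⟨_, hV.preimage hι.continuous, htV, _,
      hG.comp hι.contDiffOn (Set.mapsTo_preimage _ _), ?_⟩
    rintro y ⟨hyV, hy⟩
    exact hfG _ ⟨hyV, (insertNth_mem_Icc_iff c.box i j y).2 hy⟩
  eq_zero t ht := c.eq_zero _ fun h => ht ((insertNth_mem_Icc_iff c.box i j t).1 h)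

/-- The boundary chain of a singular block. The sign is `(-1)^(i+j)` with `i` counted from `1`,
that is `(-1)^(i+1+j)` with `i : Fin (k + 1)` counted from `0`. -/
def SingularBlock.boundary (c : SingularBlock (k + 1) U) : Chain k U :=
  ∑ i : Fin (k + 1), ∑ j : Fin 2, Finsupp.single (c.face i j) ((-1 : ℤ) ^ ((i : ℕ) + 1 + (j : ℕ)))

/-- The boundary of a chain. -/
def Chain.boundary (c : Chain (k + 1) U) : Chain k U :=
  c.sum fun s m => m • s.boundary

/-- The pullback `c^* ω` of a form along a singular block, at a point of the block. -/
def SingularBlock.pullback {m : ℕ} (c : SingularBlock k U) (ω : Form n m) (t : Fin k → ℝ) :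
    (Fin k → ℝ) [⋀^Fin m]→L[ℝ] ℝ :=
  (ω (c.toFun t)).compContinuousLinearMap (fderivWithin ℝ c.toFun (BoxIntegral.Box.Icc c.box) t)

/-- The function `f` such that `c^* ω = f dx¹ ∧ ⋯ ∧ dxᵏ`. -/
def SingularBlock.coeff (c : SingularBlock k U) (ω : Form n k) (t : Fin k → ℝ) : ℝ :=
  c.pullback ω t fun i => Pi.single i 1

/-- The Riemann integral of a function over the closed block exists and equals `y`. -/
def HasRiemannIntegral (I : BoxIntegral.Box (Fin k)) (f : (Fin k → ℝ) → ℝ) (y : ℝ) : Prop :=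
  BoxIntegral.HasIntegral I BoxIntegral.IntegrationParams.Riemann f
    BoxIntegral.BoxAdditiveMap.volume y

/-- The integral of a `k`-form over a singular `k`-block exists and equals `y`. -/
def SingularBlock.HasIntegral (c : SingularBlock k U) (ω : Form n k) (y : ℝ) : Prop :=
  HasRiemannIntegral c.box (c.coeff ω) y

/-- The integral over a singular block `c` of a `k`-form `η` that is only given on the image of
the interior of the block: the boundary of the block being negligible for the Riemann integral,
the coefficient of `c^* η` may be extended to the boundary by any values for which the Riemann
integral over the closed block exists; it does not depend on them. -/
def SingularBlock.HasInteriorIntegral (c : SingularBlock k U) (η : Form n k) (y : ℝ) : Prop :=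
  ∃ g : (Fin k → ℝ) → ℝ, (∀ t ∈ BoxIntegral.Box.Ioo c.box, g t = c.coeff η t) ∧
    HasRiemannIntegral c.box g y

/-- `∫_c ω = n₁ ∫_{c₁} ω + ⋯ + n_p ∫_{c_p} ω` exists (each integral does) and equals `y`. -/
def Chain.HasIntegral (c : Chain k U) (ω : Form n k) (y : ℝ) : Prop :=
  ∃ v : SingularBlock k U → ℝ, (∀ s ∈ c.support, s.HasIntegral ω (v s)) ∧
    y = c.sum fun s m => (m : ℝ) * v s

/-- The same for a form that is only given on the images of the interiors of the blocks. -/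
def Chain.HasInteriorIntegral (c : Chain k U) (η : Form n k) (y : ℝ) : Prop :=
  ∃ v : SingularBlock k U → ℝ, (∀ s ∈ c.support, s.HasInteriorIntegral η (v s)) ∧
    y = c.sum fun s m => (m : ℝ) * v s

end Stokes

end

/-! Since `c` is only C¹, the pullback of `ω` is continuous but need not be differentiable, so the
divergence theorem cannot be applied to it directly. The remedy is to freeze `ω` at one point at a
time.

For an interior point `p` let `η` be the constant form with value `ω (c p)`. Its pullback has zero
flux through the boundary of every box in the interior (`boxFlux_pullback_const`): for C² maps
because d commutes with pullback, for C¹ maps by smoothing. The pullback of `ω - η` is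
differentiable at `p`, because `ω - η` vanishes at `c p` and the derivative of `c` is continuous
(`hasFDerivWithinAt_compContinuousLinearMap_of_eq_zero`); its exterior derivative at `p` is the
pullback of dω. Hence the flux of the pullback of `ω`, an additive function of boxes, has the
coefficient of c^*dω as its density at every interior point, along boxes of bounded distortion.

A Henstock-type argument (`boxFlux_eq_of_hasIntegral`) turns this pointwise density into an integral
identity on boxes inside the interior, without continuity of dω. Such boxes exhaust the block; the
limit is harmless because Riemann integrable functions are bounded. Chains follow by additivity. -/

section

open MeasureTheory Set Filter Topology
open scoped BoxIntegral NNReal Convolution Manifold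

/-! ### Flux of continuous fields through boundaries of boxes. -/

namespace BoxIntegral

open IntegrationParams (GP Riemann gp_le)

/-- The flux of a vector field through the boundary of a box. -/
noncomputable def boxFlux {m : ℕ} (F : (Fin (m + 1) → ℝ) → Fin (m + 1) → ℝ)
    (I : Box (Fin (m + 1))) : ℝ :=
  ∑ i, (integral (I.face i) GP (fun x => F (i.insertNth (I.upper i) x) i) BoxAdditiveMap.volume -
    integral (I.face i) GP (fun x => F (i.insertNth (I.lower i) x) i) BoxAdditiveMap.volume)

section Flux

variable {m : ℕ} {F G : (Fin (m + 1) → ℝ) → Fin (m + 1) → ℝ} {I : Box (Fin (m + 1))}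

theorem integrable_face (hF : ContinuousOn F (Box.Icc I)) (i : Fin (m + 1)) {z : ℝ}
    (hz : z ∈ Icc (I.lower i) (I.upper i)) (l : IntegrationParams) :
    Integrable (I.face i) l (fun x => F (i.insertNth z x) i) BoxAdditiveMap.volume :=
  integrable_of_continuousOn _
    (Box.continuousOn_face_Icc ((continuous_apply i).comp_continuousOn hF) hz) volume

theorem boxFlux_sub (hF : ContinuousOn F (Box.Icc I)) (hG : ContinuousOn G (Box.Icc I)) :
    boxFlux (F - G) I = boxFlux F I - boxFlux G I := by
  unfold boxFlux
  rw [← Finset.sum_sub_distrib]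
  refine Finset.sum_congr rfl fun i _ => ?_
  have hl : I.lower i ∈ Icc (I.lower i) (I.upper i) := left_mem_Icc.2 (I.lower_le_upper i)
  have hu : I.upper i ∈ Icc (I.lower i) (I.upper i) := right_mem_Icc.2 (I.lower_le_upper i)
  have h1 := integral_sub (integrable_face hF i hu GP) (integrable_face hG i hu GP)
  have h2 := integral_sub (integrable_face hF i hl GP) (integrable_face hG i hl GP)
  change integral _ _ ((fun x => F (i.insertNth (I.upper i) x) i) -
    fun x => G (i.insertNth (I.upper i) x) i) _ - integral _ _
    ((fun x => F (i.insertNth (I.lower i) x) i) - fun x => G (i.insertNth (I.lower i) x) i) _ = _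
  rw [h1, h2]
  ring

/-- The constant depends on the box alone, so uniformly close continuous fields have close fluxes.
-/
theorem abs_boxFlux_le {ε : ℝ} (h : ∀ x ∈ Box.Icc I, ‖F x‖ ≤ ε) :
    |boxFlux F I| ≤ (∑ i, 2 * volume.real (I.face i : Set (Fin m → ℝ))) * ε := by
  unfold boxFlux
  refine (Finset.abs_sum_le_sum_abs _ _).trans ?_
  rw [Finset.sum_mul]
  refine Finset.sum_le_sum fun i _ => ?_
  have key : ∀ z ∈ Icc (I.lower i) (I.upper i),
      |integral (I.face i) GP (fun x => F (i.insertNth z x) i) BoxAdditiveMap.volume| ≤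
        volume.real (I.face i : Set (Fin m → ℝ)) * ε := fun z hz =>
    norm_integral_le_of_le_const (fun x hx =>
      (norm_le_pi_norm _ i).trans (h _ (I.mapsTo_insertNth_face_Icc hz hx))) volume
  have h1 := key _ (left_mem_Icc.2 (I.lower_le_upper i))
  have h2 := key _ (right_mem_Icc.2 (I.lower_le_upper i))
  refine (abs_sub _ _).trans ?_
  linarith

theorem boxFlux_congr (hF : ContinuousOn F (Box.Icc I)) (hG : ContinuousOn G (Box.Icc I))
    (h : EqOn F G (Box.Icc I)) : boxFlux F I = boxFlux G I := by
  have := abs_boxFlux_le (F := F - G) (I := I) (ε := 0) fun x hx => by simp [h hx]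
  rwa [mul_zero, abs_nonpos_iff, boxFlux_sub hF hG, sub_eq_zero] at this

/-- The flux of a continuous vector field is additive on subboxes. -/
theorem exists_boxAdditiveMap_boxFlux (hF : ContinuousOn F (Box.Icc I)) :
    ∃ A : Fin (m + 1) →ᵇᵃ[I] ℝ, ∀ J, A J = boxFlux F J := by
  let fI : Fin (m + 1) → ℝ → Box (Fin m) → ℝ := fun i y J =>
    integral J GP (fun x => F (i.insertNth y x) i) BoxAdditiveMap.volume
  let fb : ∀ i, Icc (I.lower i) (I.upper i) → Fin m →ᵇᵃ[I.face i] ℝ := fun i x =>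
    (integrable_face hF i x.2 GP).toBoxAdditive
  -- In each direction the flux is a face integral, additive in the face, at the upper end minus the
  -- same at the lower end; contributions of interior faces cancel.
  let A : Fin (m + 1) → Fin (m + 1) →ᵇᵃ[I] ℝ := fun i =>
    BoxAdditiveMap.upperSubLower I i (fI i) (fb i) fun x _ J => rfl
  refine ⟨⟨fun J => ∑ i, A i J, fun J hJ π hπ => ?_⟩, fun J => rfl⟩
  rw [Finset.sum_comm]
  exact Finset.sum_congr rfl fun i _ => (A i).sum_partition_boxes hJ hπ

/-- Near a point of differentiability, the flux is the divergence times the volume, up to a small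
error. -/
theorem volume_sub_boxFlux_le {F' : (Fin (m + 1) → ℝ) →L[ℝ] Fin (m + 1) → ℝ}
    {x : Fin (m + 1) → ℝ} (hF : ContinuousOn F (Box.Icc I))
    (hd : HasFDerivWithinAt F F' (Box.Icc I) x) (c : ℝ≥0) {ε : ℝ} (hε : 0 < ε) :
    ∃ δ > 0, ∀ J ≤ I, Box.Icc J ⊆ Metric.closedBall x δ → x ∈ Box.Icc J → J.distortion ≤ c →
      |(∏ j, (J.upper j - J.lower j)) * ∑ i, F' (Pi.single i 1) i - boxFlux F J| ≤
        ε * ∏ j, (J.upper j - J.lower j) := by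
  -- Each of the `m + 1` directions costs `2 * ε' * c` times the volume.
  obtain ⟨ε', hε', hlt⟩ := exists_pos_mul_lt hε ((m + 1) * (2 * c))
  obtain ⟨δ, δ0, Hδ⟩ := (nhdsWithin_hasBasis Metric.nhds_basis_closedBall _).mem_iff.1
    (hd.isLittleO.def hε')
  refine ⟨δ, δ0, fun J hle hJδ hxJ hJc => ?_⟩
  have hpos : 0 ≤ ∏ j, (J.upper j - J.lower j) :=
    Finset.prod_nonneg fun j _ => sub_nonneg.2 (J.lower_le_upper j)
  have key : ∀ i, |(∏ j, (J.upper j - J.lower j)) * F' (Pi.single i 1) i -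
      (integral (J.face i) GP (fun x => F (i.insertNth (J.upper i) x) i) BoxAdditiveMap.volume -
      integral (J.face i) GP (fun x => F (i.insertNth (J.lower i) x) i) BoxAdditiveMap.volume)| ≤
      2 * ε' * c * ∏ j, (J.upper j - J.lower j) := by
    intro i
    refine norm_volume_sub_integral_face_upper_sub_lower_smul_le J (f := fun y => F y i)
      (f' := (ContinuousLinearMap.proj i).comp F') (a := F x i)
      ((continuous_apply i).comp_continuousOn (hF.mono (Box.le_iff_Icc.1 hle))) hxJ hε'
      (fun y hy => ?_) hJc
    exact (norm_le_pi_norm (F y - F x - F' (y - x)) i).trans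
      (Hδ ⟨hJδ hy, Box.le_iff_Icc.1 hle hy⟩)
  unfold boxFlux
  rw [Finset.mul_sum, ← Finset.sum_sub_distrib]
  refine (Finset.abs_sum_le_sum_abs _ _).trans ((Finset.sum_le_sum fun i _ => key i).trans ?_)
  rw [Finset.sum_const, Finset.card_univ, Fintype.card_fin, nsmul_eq_mul, ← mul_assoc]
  refine mul_le_mul_of_nonneg_right ?_ hpos
  push_cast
  linarith

/-- The flux depends continuously on the box. -/
theorem tendsto_boxFlux (hF : ContinuousOn F (Box.Icc I)) (J : ℕ →o Box (Fin (m + 1)))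
    (hJ_sub' : ∀ k, Box.Icc (J k) ⊆ Box.Icc I)
    (hJl : Tendsto (Box.lower ∘ J) atTop (𝓝 I.lower))
    (hJu : Tendsto (Box.upper ∘ J) atTop (𝓝 I.upper)) :
    Tendsto (fun k => boxFlux F (J k)) atTop (𝓝 (boxFlux F I)) := by
  have hJ_le : ∀ k, J k ≤ I := fun k => Box.le_iff_Icc.2 (hJ_sub' k)
  rw [tendsto_pi_nhds] at hJl hJu
  -- Both the face and its height vary with `k`; here `c k` is the height.
  suffices H : ∀ (i : Fin (m + 1)) (c : ℕ → ℝ) (d), (∀ k, c k ∈ Icc (I.lower i) (I.upper i)) →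
    Tendsto c atTop (𝓝 d) →
      Tendsto (fun k => ∫ x in Box.Icc ((J k).face i), F (i.insertNth (c k) x) i) atTop
        (𝓝 <| ∫ x in Box.Icc (I.face i), F (i.insertNth d x) i) by
    have conv : ∀ (K : Box (Fin (m + 1))), K ≤ I → ∀ (i : Fin (m + 1)) (z : ℝ),
        z ∈ Icc (K.lower i) (K.upper i) →
        integral (K.face i) GP (fun x => F (i.insertNth z x) i) BoxAdditiveMap.volume =
          ∫ x in Box.Icc (K.face i), F (i.insertNth z x) i := by
      intro K hK i z hz
      have := Box.continuousOn_face_Icc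
        ((continuous_apply i).comp_continuousOn (hF.mono (Box.le_iff_Icc.1 hK))) hz
      have := (this.integrableOn_compact (μ := volume) (Box.isCompact_Icc _)).mono_set
        Box.coe_subset_Icc
      rw [← setIntegral_congr_set (Box.coe_ae_eq_Icc _)]
      exact (this.hasBoxIntegral ⊥ rfl).integral_eq
    have hl : ∀ (K : Box (Fin (m + 1))) i, K.lower i ∈ Icc (K.lower i) (K.upper i) :=
      fun K i => left_mem_Icc.2 (K.lower_le_upper i)
    have hu : ∀ (K : Box (Fin (m + 1))) i, K.upper i ∈ Icc (K.lower i) (K.upper i) :=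
      fun K i => right_mem_Icc.2 (K.lower_le_upper i)
    have hfl : ∀ K ≤ I, boxFlux F K = ∑ i, ((∫ x in Box.Icc (K.face i),
        F (i.insertNth (K.upper i) x) i) - ∫ x in Box.Icc (K.face i),
        F (i.insertNth (K.lower i) x) i) := fun K hK =>
      Finset.sum_congr rfl fun i _ => by rw [conv K hK i _ (hl K i), conv K hK i _ (hu K i)]
    rw [hfl I le_rfl]
    simp_rw [fun k => hfl (J k) (hJ_le k)]
    rw [Box.Icc_eq_pi] at hJ_sub'
    refine tendsto_finsetSum _ fun i _ =>
      (H _ _ _ ?_ (hJu _)).sub (H _ _ _ ?_ (hJl _))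
    exacts [fun k => hJ_sub' k (J k).upper_mem_Icc _ trivial, fun k =>
      hJ_sub' k (J k).lower_mem_Icc _ trivial]
  intro i c d hc hcd
  have hd : d ∈ Icc (I.lower i) (I.upper i) :=
    isClosed_Icc.mem_of_tendsto hcd (Eventually.of_forall hc)
  have Hic : ∀ k, IntegrableOn (fun x => F (i.insertNth (c k) x) i) (Box.Icc (I.face i)) := fun k =>
    (Box.continuousOn_face_Icc ((continuous_apply i).comp_continuousOn hF) (hc k)).integrableOn_Icc
  have Hid : IntegrableOn (fun x => F (i.insertNth d x) i) (Box.Icc (I.face i)) :=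
    (Box.continuousOn_face_Icc ((continuous_apply i).comp_continuousOn hF) hd).integrableOn_Icc
  -- With the height fixed at the limit, the open faces increase to the open limit face.
  have H :
    Tendsto (fun k => ∫ x in Box.Icc ((J k).face i), F (i.insertNth d x) i) atTop
      (𝓝 <| ∫ x in Box.Icc (I.face i), F (i.insertNth d x) i) := by
    have hIoo : (⋃ k, Box.Ioo ((J k).face i)) = Box.Ioo (I.face i) :=
      Box.iUnion_Ioo_of_tendsto ((Box.monotone_face i).comp J.monotone)
        (tendsto_pi_nhds.2 fun _ => hJl _) (tendsto_pi_nhds.2 fun _ => hJu _)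
    simp only [IntegrableOn, ← Measure.restrict_congr_set (Box.Ioo_ae_eq_Icc _), ← hIoo] at Hid ⊢
    exact tendsto_setIntegral_of_monotone (fun k => ((J k).face i).measurableSet_Ioo)
      (Box.Ioo.monotone.comp ((Box.monotone_face i).comp J.monotone)) Hid
  -- Replacing the height `d` by `c k` costs at most `ε`, by uniform continuity of `F`.
  refine H.congr_dist (Metric.nhds_basis_closedBall.tendsto_right_iff.2 fun ε εpos => ?_)
  have hvol_pos : ∀ J : Box (Fin m), 0 < ∏ j, (J.upper j - J.lower j) := fun J =>
    Finset.prod_pos fun j hj => sub_pos.2 <| J.lower_lt_upper _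
  rcases Metric.uniformContinuousOn_iff_le.1 (I.isCompact_Icc.uniformContinuousOn_of_continuous hF)
      (ε / ∏ j, ((I.face i).upper j - (I.face i).lower j)) (div_pos εpos (hvol_pos (I.face i)))
    with ⟨δ, δpos, hδ⟩
  refine (hcd.eventually (Metric.ball_mem_nhds _ δpos)).mono fun k hk => ?_
  have Hsub : Box.Icc ((J k).face i) ⊆ Box.Icc (I.face i) :=
    Box.le_iff_Icc.1 (Box.face_mono (hJ_le _) i)
  rw [mem_closedBall_zero_iff, Real.norm_eq_abs, abs_of_nonneg dist_nonneg, dist_eq_norm,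
    ← MeasureTheory.integral_sub (Hid.mono_set Hsub) ((Hic _).mono_set Hsub)]
  calc
    ‖∫ x in Box.Icc ((J k).face i), F (i.insertNth d x) i - F (i.insertNth (c k) x) i‖ ≤
        (ε / ∏ j, ((I.face i).upper j - (I.face i).lower j)) *
          (volume (Box.Icc ((J k).face i))).toReal := by
      refine norm_setIntegral_le_of_norm_le_const (((J k).face i).measure_Icc_lt_top _)
        fun x hx => ?_
      rw [← dist_eq_norm]
      calc
        dist (F (i.insertNth d x) i) (F (i.insertNth (c k) x) i) ≤
            dist (F (i.insertNth d x)) (F (i.insertNth (c k) x)) :=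
          dist_le_pi_dist (F (i.insertNth d x)) (F (i.insertNth (c k) x)) i
        _ ≤ ε / ∏ j, ((I.face i).upper j - (I.face i).lower j) :=
          hδ _ (I.mapsTo_insertNth_face_Icc hd <| Hsub hx) _
            (I.mapsTo_insertNth_face_Icc (hc _) <| Hsub hx) ?_
      rw [Fin.dist_insertNth_insertNth, dist_self, dist_comm]
      exact max_le hk.le δpos.lt.le
    _ ≤ ε := by
      rw [Box.Icc_def, Real.volume_Icc_pi_toReal ((J k).face i).lower_le_upper,
        ← le_div_iff₀ (hvol_pos _)]
      gcongr
      exacts [hvol_pos _, fun _ _ ↦ sub_nonneg.2 (Box.lower_le_upper _ _),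
        (hJ_sub' _ (J _).upper_mem_Icc).2 _, (hJ_sub' _ (J _).lower_mem_Icc).1 _]

end Flux

/-! ### Boundedness of Riemann integrable functions and exhaustion by subboxes. -/

section RiemannIntegral

variable {ι : Type*} [Fintype ι] {I : Box ι} {g : (ι → ℝ) → ℝ}

/-- A Riemann integrable function is bounded on the closed box. -/
theorem exists_bound_of_integrable_Riemann (h : Integrable I Riemann g BoxAdditiveMap.volume) :
    ∃ M, ∀ x ∈ Box.Icc I, ‖g x‖ ≤ M := by
  classical
  obtain ⟨r, hr, H⟩ := hasIntegral_iff.1 h.hasIntegral 1 one_pos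
  -- For the Riemann integral the gauge is a constant radius.
  obtain ⟨⟨r₀, hr₀⟩, hr'⟩ : ∃ r₀ : Ioi (0 : ℝ), ∀ x, r 0 x = r₀ := ⟨r 0 0, hr 0 rfl⟩
  have hr₀' : (0 : ℝ) < r₀ := hr₀
  -- With half the radius, a tag may move anywhere in its closed box and the partition stays
  -- admissible for `r₀`.
  obtain ⟨π, hπ, hπH, hπS, -⟩ := Box.exists_taggedPartition_isHenstock_isSubordinate_homothetic I
    fun _ => ⟨r₀ / 2, half_pos hr₀'⟩
  have hmem : ∀ π' : TaggedPrepartition I, π'.toPrepartition = π.toPrepartition →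
      (∀ J ∈ π.boxes, π'.tag J ∈ Box.Icc J) →
      dist (integralSum g BoxAdditiveMap.volume π') (integral I Riemann g BoxAdditiveMap.volume)
        ≤ 1 := by
    intro π' hπ' htag
    have hb : ∀ J, J ∈ π' ↔ J ∈ π.boxes := fun J => by
      rw [← hπ']; rfl
    refine H 0 π' ⟨fun J hJ => ?_, fun _ J hJ => htag J ((hb J).1 hJ), fun h => (Bool.false_ne_true h).elim,
      fun h => (Bool.false_ne_true h).elim⟩ ?_
    · have hJ' := (hb J).1 hJ
      intro t ht
      rw [hr']
      have h1 := hπS J hJ' ht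
      have h2 := hπS J hJ' (htag J hJ')
      rw [Metric.mem_closedBall] at h1 h2 ⊢
      calc dist t (π'.tag J) ≤ dist t (π.tag J) + dist (π'.tag J) (π.tag J) :=
            dist_triangle_right _ _ _
        _ ≤ r₀ / 2 + r₀ / 2 := add_le_add h1 h2
        _ = r₀ := add_halves _
    · change π'.toPrepartition.IsPartition
      rw [hπ']; exact hπ
  have hbox : ∀ J ∈ π.boxes, ∃ M, ∀ x ∈ Box.Icc J, ‖g x‖ ≤ M := by
    intro J hJ
    have hJvol : 0 < volume.real (J : Set (ι → ℝ)) := by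
      rw [← Measure.toBoxAdditive_apply, Box.volume_apply]
      exact Finset.prod_pos fun j _ => sub_pos.2 (J.lower_lt_upper j)
    -- Moving the tag of `J` alone to `t` changes one term of the sum. Both sums lie within 1 of the
    -- integral, whence the 2.
    refine ⟨‖g (π.tag J)‖ + 2 / volume.real (J : Set (ι → ℝ)), fun t ht => ?_⟩
    let π' : TaggedPrepartition I :=
      ⟨π.toPrepartition, Function.update π.tag J t, fun K => by
        by_cases hK : K = J
        · subst hK
          simpa using Box.le_iff_Icc.1 (π.le_of_mem' _ hJ) ht
        · simpa [hK] using π.tag_mem_Icc K⟩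
    have h1 := hmem π rfl fun J hJ => hπH J hJ
    have h2 := hmem π' rfl fun K hK => by
      by_cases hKJ : K = J
      · subst hKJ; simpa [π'] using ht
      · simpa [π', hKJ] using hπH K hK
    have h3 : integralSum g BoxAdditiveMap.volume π' - integralSum g BoxAdditiveMap.volume π =
        volume.real (J : Set (ι → ℝ)) * (g t - g (π.tag J)) := by
      unfold integralSum
      change ∑ K ∈ π.boxes, _ - ∑ K ∈ π.boxes, _ = _
      rw [← Finset.sum_sub_distrib, Finset.sum_eq_single_of_mem J hJ]
      · simp [π', BoxAdditiveMap.volume, mul_sub]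
      · intro K _ hKJ
        simp [π', hKJ]
    have h4 : |volume.real (J : Set (ι → ℝ)) * (g t - g (π.tag J))| ≤ 2 := by
      rw [← h3, ← Real.dist_eq]
      exact (dist_triangle_right _ _ _).trans ((add_le_add h2 h1).trans_eq (by norm_num))
    rw [abs_mul, abs_of_pos hJvol, ← le_div_iff₀' hJvol] at h4
    have h5 := norm_sub_norm_le (g t) (g (π.tag J))
    rw [Real.norm_eq_abs (g t - _)] at h5
    linarith
  choose! M hM using hbox
  refine ⟨∑ J ∈ π.boxes, |M J|, fun x hx => ?_⟩
  -- Boxes are half-open, so the partition covers only `I`; the finite union of closed boxes then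
  -- covers the closure.
  have hcl : Box.Icc I ⊆ ⋃ J ∈ π.boxes, Box.Icc J := by
    have hI : closure (I : Set (ι → ℝ)) = Box.Icc I := by
      simp [Box.coe_eq_pi, Box.Icc_eq_pi, closure_pi_set, I.lower_ne_upper]
    rw [← hI]
    refine closure_minimal ?_ ?_
    · rw [← hπ.iUnion_eq]
      exact iUnion₂_mono fun J _ => Box.coe_subset_Icc
    · exact π.boxes.finite_toSet.isClosed_biUnion fun J _ => J.isCompact_Icc.isClosed
  obtain ⟨J, hJ, hxJ⟩ := mem_iUnion₂.1 (hcl hx)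
  exact (hM J hJ x hxJ).trans ((le_abs_self _).trans
    (Finset.single_le_sum (f := fun J => |M J|) (fun _ _ => abs_nonneg _) hJ))

/-- The complement of `J` in `I` is a finite disjoint union of boxes, over which integral and volume
both add up. -/
theorem abs_integral_sub_integral_le {l : IntegrationParams}
    (h : Integrable I l g BoxAdditiveMap.volume) {M : ℝ}
    (hM : ∀ x ∈ Box.Icc I, ‖g x‖ ≤ M) {J : Box ι} (hJ : J ≤ I) :
    |integral I l g BoxAdditiveMap.volume - integral J l g BoxAdditiveMap.volume| ≤
      (volume.real (I : Set (ι → ℝ)) - volume.real (J : Set (ι → ℝ))) * M := by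
  classical
  set π := Prepartition.single I J hJ
  have hdisj : Disjoint π.iUnion π.compl.iUnion := by
    rw [Prepartition.iUnion_compl]; exact disjoint_sdiff_self_right
  have hpart : (π.disjUnion π.compl hdisj).IsPartition :=
    Prepartition.isPartitionDisjUnionOfEqDiff π.iUnion_compl
  have hsplit : ∀ A : ι →ᵇᵃ[I] ℝ, A I - A J = ∑ K ∈ π.compl.boxes, A K := by
    intro A
    rw [← A.sum_partition_boxes le_rfl hpart, Prepartition.disjUnion_boxes, Prepartition.sum_disj_union_boxes hdisj]
    simp [π]
  have h1 := hsplit h.toBoxAdditive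
  have h2 := hsplit ((volume : Measure (ι → ℝ)).toBoxAdditive.restrict _ le_top)
  change integral I l g _ - integral J l g _ = ∑ K ∈ _, integral K l g _ at h1
  change volume.real (I : Set (ι → ℝ)) - volume.real (J : Set (ι → ℝ)) =
    ∑ K ∈ π.compl.boxes, volume.real (K : Set (ι → ℝ)) at h2
  rw [h1, h2, Finset.sum_mul]
  refine (Finset.abs_sum_le_sum_abs _ _).trans (Finset.sum_le_sum fun K hK => ?_)
  exact norm_integral_le_of_le_const
    (fun x hx => hM x (Box.le_iff_Icc.1 (π.compl.le_of_mem' _ hK) hx)) volume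

theorem tendsto_integral_subbox (h : Integrable I Riemann g BoxAdditiveMap.volume)
    {J : ℕ → Box ι} (hJ : ∀ k, J k ≤ I)
    (hJl : Tendsto (Box.lower ∘ J) atTop (𝓝 I.lower))
    (hJu : Tendsto (Box.upper ∘ J) atTop (𝓝 I.upper)) :
    Tendsto (fun k => integral (J k) Riemann g BoxAdditiveMap.volume) atTop
      (𝓝 (integral I Riemann g BoxAdditiveMap.volume)) := by
  obtain ⟨M, hM⟩ := exists_bound_of_integrable_Riemann h
  rw [tendsto_pi_nhds] at hJl hJu
  have hvol : ∀ K : Box ι, volume.real (K : Set (ι → ℝ)) = ∏ j, (K.upper j - K.lower j) :=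
    fun K => by rw [← Measure.toBoxAdditive_apply, Box.volume_apply]
  have hlim : Tendsto (fun k => (volume.real (I : Set (ι → ℝ)) -
      volume.real (J k : Set (ι → ℝ))) * M) atTop (𝓝 0) := by
    simp_rw [hvol]
    have := ((tendsto_const_nhds (x := ∏ j, (I.upper j - I.lower j))).sub
      (tendsto_finsetProd Finset.univ fun j _ => (hJu j).sub (hJl j))).mul_const M
    simpa using this
  rw [tendsto_iff_dist_tendsto_zero]
  refine squeeze_zero (fun _ => dist_nonneg) (fun k => ?_) hlim
  rw [dist_comm, Real.dist_eq]
  exact abs_integral_sub_integral_le h hM (hJ k)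

end RiemannIntegral

/-! ### The divergence theorem with frozen fields. -/

/-- A divergence theorem: the divergence of `F` at an interior point `p` is that of a vector field
`H` differentiable at `p` such that `F - H` has zero flux through the boundaries of boxes in the
interior. -/
theorem boxFlux_eq_of_hasIntegral {m : ℕ} {F : (Fin (m + 1) → ℝ) → Fin (m + 1) → ℝ}
    {I : Box (Fin (m + 1))} {g : (Fin (m + 1) → ℝ) → ℝ} {y : ℝ}
    (hF : ContinuousOn F (Box.Icc I))
    (hg : HasIntegral I Riemann g BoxAdditiveMap.volume y)
    (hd : ∀ p ∈ Box.Ioo I, ∃ (H : (Fin (m + 1) → ℝ) → Fin (m + 1) → ℝ)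
      (H' : (Fin (m + 1) → ℝ) →L[ℝ] Fin (m + 1) → ℝ), ContinuousOn H (Box.Icc I) ∧
      (∀ J, Box.Icc J ⊆ Box.Ioo I → boxFlux (F - H) J = 0) ∧
      HasFDerivWithinAt H H' (Box.Icc I) p ∧ ∑ i, H' (Pi.single i 1) i = g p) :
    boxFlux F I = y := by
  -- `hd` says nothing at boundary points, so the two sides are compared on boxes inside the
  -- interior and passed to the limit.
  obtain ⟨J, hJ_sub, hJl, hJu⟩ := I.exists_seq_mono_tendsto
  have hJ_sub' : ∀ k, Box.Icc (J k) ⊆ Box.Icc I := fun k => (hJ_sub k).trans I.Ioo_subset_Icc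
  have hJ_le : ∀ k, J k ≤ I := fun k => Box.le_iff_Icc.2 (hJ_sub' k)
  have h1 := tendsto_integral_subbox hg.integrable hJ_le hJl hJu
  rw [hg.integral_eq] at h1
  refine tendsto_nhds_unique (tendsto_boxFlux hF J hJ_sub' hJl hJu) (h1.congr fun k => ?_)
  set K := J k
  -- The `GP` integral extends the Riemann one and uses boxes of bounded distortion, as the local
  -- estimate requires. By its uniqueness it is enough that the flux is also a `GP` integral of `g`.
  have hKint := (hg.integrable.to_subbox (hJ_le k)).hasIntegral.mono (bot_le : GP ≤ Riemann)
  obtain ⟨A, hA⟩ := exists_boxAdditiveMap_boxFlux (hF.mono (hJ_sub' k))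
  rw [← hA]
  refine hKint.unique (HasIntegral.of_le_Henstock_of_forall_isLittleO gp_le
    ((volume : Measure (Fin (m + 1) → ℝ)).toBoxAdditive.restrict _ le_top)
    (fun J => ENNReal.toReal_nonneg) A ∅ countable_empty (fun _ _ hx => hx.2.elim) ?_)
  intro c x hx ε hε
  obtain ⟨H, H', hHc, hflux, hH', hdiv⟩ := hd x (hJ_sub k hx.1)
  obtain ⟨δ, hδ, hest⟩ := volume_sub_boxFlux_le (hHc.mono (hJ_sub' k))
    (hH'.mono (hJ_sub' k)) c hε
  refine ⟨δ, hδ, fun L hLK hLδ hxL hLc => ?_⟩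
  have hLsub : Box.Icc L ⊆ Box.Icc I := (Box.le_iff_Icc.1 hLK).trans (hJ_sub' k)
  have h2 := hest L hLK hLδ hxL (hLc rfl)
  -- On small boxes at `x` the flux of `F` is that of `H`, to which differentiability at `x`
  -- applies.
  have h3 := hflux L ((Box.le_iff_Icc.1 hLK).trans (hJ_sub k))
  rw [boxFlux_sub (hF.mono hLsub) (hHc.mono hLsub), sub_eq_zero] at h3
  rw [hA, h3, Real.dist_eq, BoxAdditiveMap.volume_apply, smul_eq_mul, ← hdiv]
  refine h2.trans_eq ?_
  rw [← Box.volume_apply]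
  rfl

end BoxIntegral

/-! ### Pullback of a form that vanishes at a point. -/

namespace ContinuousAlternatingMap

variable {E F G : Type*} [NormedAddCommGroup E] [NormedSpace ℝ E] [NormedAddCommGroup F]
  [NormedSpace ℝ F] [NormedAddCommGroup G] [NormedSpace ℝ G] {k : ℕ}

theorem continuous_compContinuousLinearMap_uncurry :
    Continuous fun p : (F [⋀^Fin k]→L[ℝ] G) × (E →L[ℝ] F) =>
      p.1.compContinuousLinearMap p.2 :=
  continuous_iff_continuousAt.2 fun p =>
    (hasStrictFDerivAt_compContinuousLinearMap p).hasFDerivAt.continuousAt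

/-- The pullback of a form vanishing at a point is differentiable there as soon as the form is
differentiable and the linear maps are continuous. -/
theorem hasFDerivWithinAt_compContinuousLinearMap_of_eq_zero {X : Type*} [NormedAddCommGroup X]
    [NormedSpace ℝ X] {u : X → F [⋀^Fin k]→L[ℝ] G} {u' : X →L[ℝ] F [⋀^Fin k]→L[ℝ] G}
    {A : X → E →L[ℝ] F} {s : Set X} {p : X} (hu : HasFDerivWithinAt u u' s p) (hp : u p = 0)
    (hA : ContinuousWithinAt A s p) :
    HasFDerivWithinAt (fun t => (u t).compContinuousLinearMap (A t))
      (compContinuousLinearMapCLM (A p) ∘L u') s p := by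
  -- The strict derivative compares the values at `(u t, A t)` and `(0, A t)`. The second value is
  -- zero and the increment is `(u t, 0)`, so no derivative of `A` is needed.
  have hstrict := (hasStrictFDerivAt_compContinuousLinearMap (u p, A p)).isLittleO
  have hlim : Tendsto (fun t => ((u t, A t), ((0 : F [⋀^Fin k]→L[ℝ] G), A t))) (𝓝[s] p)
      (𝓝 ((u p, A p), (u p, A p))) := by
    have h1 : Tendsto u (𝓝[s] p) (𝓝 (u p)) := hu.continuousWithinAt
    have h2 : Tendsto A (𝓝[s] p) (𝓝 (A p)) := hA
    have h3 : Tendsto (fun _ : X => (0 : F [⋀^Fin k]→L[ℝ] G)) (𝓝[s] p) (𝓝 (u p)) := by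
      rw [hp]; exact tendsto_const_nhds
    exact (h1.prodMk_nhds h2).prodMk_nhds (h3.prodMk_nhds h2)
  have h1 := hstrict.comp_tendsto hlim
  have hbig : (fun t => ((u t, A t) : (F [⋀^Fin k]→L[ℝ] G) × (E →L[ℝ] F)) - (0, A t))
      =O[𝓝[s] p] fun t => t - p := by
    refine Asymptotics.IsBigO.trans (g := u) ?_ ?_
    · refine Asymptotics.IsBigO.of_bound 1 (Eventually.of_forall fun t => ?_)
      simp
    · simpa [hp] using hu.isBigO_sub
  have h2 := h1.trans_isBigO hbig
  have h3 : HasFDerivWithinAt (compContinuousLinearMapCLM (A p) ∘ u)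
      (compContinuousLinearMapCLM (A p) ∘L u') s p :=
    (compContinuousLinearMapCLM (𝕜 := ℝ) (A p)).hasFDerivAt.comp_hasFDerivWithinAt p hu
  refine HasFDerivWithinAt.of_isLittleO ?_
  refine (h2.add h3.isLittleO).congr_left fun t => ?_
  have hz : ∀ B : E →L[ℝ] F,
      (0 : F [⋀^Fin k]→L[ℝ] G).compContinuousLinearMap B = 0 := fun B => by ext; rfl
  simp [hp, hz]

end ContinuousAlternatingMap

/-! ### Pullbacks of constant forms have zero flux. -/

namespace BoxIntegral

open IntegrationParams (GP Riemann gp_le)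

variable {m : ℕ}

/-- The vector field corresponding to an `m`-form on `ℝ^(m + 1)`: its exterior derivative is the
divergence of this field. -/
noncomputable def formField (m : ℕ) :
    ((Fin (m + 1) → ℝ) [⋀^Fin m]→L[ℝ] ℝ) →L[ℝ] (Fin (m + 1) → ℝ) :=
  ContinuousLinearMap.pi fun i => ((-1 : ℝ) ^ (i : ℕ)) •
    ContinuousAlternatingMap.apply ℝ (Fin (m + 1) → ℝ) ℝ
      (i.removeNth fun l : Fin (m + 1) => (Pi.single l 1 : Fin (m + 1) → ℝ))

theorem formField_apply (P : (Fin (m + 1) → ℝ) [⋀^Fin m]→L[ℝ] ℝ) (i : Fin (m + 1)) :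
    formField m P i = (-1 : ℝ) ^ (i : ℕ) *
      P fun l => (Pi.single (i.succAbove l) 1 : Fin (m + 1) → ℝ) := rfl

theorem sum_formField_comp_apply
    (P' : (Fin (m + 1) → ℝ) →L[ℝ] (Fin (m + 1) → ℝ) [⋀^Fin m]→L[ℝ] ℝ) :
    ∑ i, (formField m ∘L P') (Pi.single i 1) i =
      ContinuousAlternatingMap.alternatizeUncurryFin P' fun i => Pi.single i 1 := by
  rw [ContinuousAlternatingMap.alternatizeUncurryFin_apply]
  refine Finset.sum_congr rfl fun i _ => ?_
  simp [formField_apply]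
  rfl

variable {E : Type*} [NormedAddCommGroup E] [NormedSpace ℝ E]

/-- The divergence is the coefficient of d(g^*η) = g^*(dη), which is zero as `η` is constant; `C²`
lets d commute with pullback. -/
theorem boxFlux_pullback_const_of_contDiff_two (η : E [⋀^Fin m]→L[ℝ] ℝ)
    {g : (Fin (m + 1) → ℝ) → E} (hg : ContDiff ℝ 2 g) (J : Box (Fin (m + 1))) :
    boxFlux (fun t => formField m (η.compContinuousLinearMap (fderiv ℝ g t))) J = 0 := by
  have hd : Differentiable ℝ (fderiv ℝ g) :=
    (hg.fderiv_right (m := 1) (by norm_num)).differentiable one_ne_zero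
  have hP : Differentiable ℝ fun t => η.compContinuousLinearMap (fderiv ℝ g t) := fun t =>
    (differentiableAt_const η).continuousAlternatingMapCompContinuousLinearMap (hd t)
  have h := hasIntegral_GP_divergence_of_forall_hasDerivWithinAt J
    (fun t => formField m (η.compContinuousLinearMap (fderiv ℝ g t)))
    (fun t => formField m ∘L fderiv ℝ (fun t => η.compContinuousLinearMap (fderiv ℝ g t)) t) ∅
    countable_empty (fun _ hx => hx.elim) fun t _ =>
      ((formField m).hasFDerivAt.comp t (hP t).hasFDerivAt).hasFDerivWithinAt
  refine h.unique ?_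
  have h0 : ∀ t, ∑ i, (formField m ∘L fderiv ℝ
      (fun t => η.compContinuousLinearMap (fderiv ℝ g t)) t) (Pi.single i 1) i = 0 := by
    intro t
    rw [sum_formField_comp_apply]
    have := extDeriv_pullback (𝕜 := ℝ) (ω := fun _ : E => η) (f := g) (x := t) (r := 2)
      (differentiableAt_const η) hg.contDiffAt (by simp)
    rw [extDeriv] at this
    rw [this, extDeriv]
    simp [ContinuousAlternatingMap.alternatizeUncurryFin_apply]
  simp only [h0]
  exact hasIntegral_zero

variable [CompleteSpace E]

/-- A compactly supported `C¹` map is approximated by smooth maps uniformly in its derivative. -/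
theorem exists_contDiff_fderiv_near {V : Type*} [NormedAddCommGroup V] [NormedSpace ℝ V]
    [FiniteDimensional ℝ V] {g : V → E} (hg : ContDiff ℝ 1 g) (hc : HasCompactSupport g) {ε : ℝ}
    (hε : 0 < ε) :
    ∃ h : V → E, ContDiff ℝ 2 h ∧ ∀ t, dist (fderiv ℝ h t) (fderiv ℝ g t) ≤ ε := by
  borelize V
  let μ : Measure V := Measure.addHaar
  have hcont : Continuous (fderiv ℝ g) := hg.continuous_fderiv one_ne_zero
  have hu : UniformContinuous (fderiv ℝ g) :=
    (hc.fderiv ℝ).uniformContinuous_of_continuous hcont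
  obtain ⟨δ, hδ, H⟩ := Metric.uniformContinuous_iff_le.1 hu ε hε
  let φ : ContDiffBump (0 : V) := ⟨δ / 2, δ, half_pos hδ, half_lt_self hδ⟩
  refine ⟨φ.normed μ ⋆[ContinuousLinearMap.lsmul ℝ ℝ, μ] g,
    φ.hasCompactSupport_normed.contDiff_convolution_left _ φ.contDiff_normed
      hg.continuous.locallyIntegrable, fun t => ?_⟩
  have hder := (hc.hasFDerivAt_convolution_right (ContinuousLinearMap.lsmul ℝ ℝ)
    φ.continuous_normed.locallyIntegrable hg t : HasFDerivAt
      (φ.normed μ ⋆[ContinuousLinearMap.lsmul ℝ ℝ, μ] g) _ t)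
  rw [hder.fderiv]
  -- The derivative of the mollified map is the mollified derivative, so it is close to `fderiv ℝ g`
  -- by uniform continuity.
  have hL : (ContinuousLinearMap.lsmul ℝ ℝ : ℝ →L[ℝ] E →L[ℝ] E).precompR V =
      (ContinuousLinearMap.lsmul ℝ ℝ : ℝ →L[ℝ] (V →L[ℝ] E) →L[ℝ] (V →L[ℝ] E)) := by
    ext; simp
  rw [hL]
  refine φ.dist_normed_convolution_le hcont.aestronglyMeasurable fun x hx => H ?_
  exact (Metric.mem_ball.1 hx).le

/-- The flux involves only first derivatives of `g`, so it is a limit of the zero fluxes of C²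
approximations. -/
theorem boxFlux_pullback_const_of_hasCompactSupport (η : E [⋀^Fin m]→L[ℝ] ℝ)
    {g : (Fin (m + 1) → ℝ) → E} (hg : ContDiff ℝ 1 g) (hc : HasCompactSupport g)
    (J : Box (Fin (m + 1))) :
    boxFlux (fun t => formField m (η.compContinuousLinearMap (fderiv ℝ g t))) J = 0 := by
  let Φ : ((Fin (m + 1) → ℝ) →L[ℝ] E) → Fin (m + 1) → ℝ := fun A =>
    formField m (η.compContinuousLinearMap A)
  have hΦ : Continuous Φ := (formField m).continuous.comp
    (ContinuousAlternatingMap.continuous_compContinuousLinearMap_uncurry.comp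
      (continuous_const.prodMk continuous_id))
  have hcont : Continuous (fderiv ℝ g) := hg.continuous_fderiv one_ne_zero
  set C := ∑ i, 2 * volume.real (J.face i : Set (Fin m → ℝ))
  have key : ∀ ε > 0, |boxFlux (fun t => Φ (fderiv ℝ g t)) J| ≤ C * ε := by
    intro ε hε
    -- `Φ` need not be uniformly continuous, but near the compact set of derivatives over the box
    -- one `δ` serves all points.
    have hK : IsCompact (fderiv ℝ g '' Box.Icc J) := J.isCompact_Icc.image hcont
    obtain ⟨δ, hδ, H⟩ := Metric.mem_uniformity_dist.1
      (hK.uniformContinuousAt_of_continuousAt Φ (fun _ _ => hΦ.continuousAt)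
        (Metric.dist_mem_uniformity hε))
    obtain ⟨h, hh, hd⟩ := exists_contDiff_fderiv_near hg hc (half_pos hδ)
    have h0 : boxFlux (fun t => Φ (fderiv ℝ h t)) J = 0 :=
      boxFlux_pullback_const_of_contDiff_two η hh J
    have hhc : Continuous (fderiv ℝ h) := hh.continuous_fderiv two_ne_zero
    have h1 := boxFlux_sub (I := J) (hΦ.comp hcont).continuousOn (hΦ.comp hhc).continuousOn
    change _ = boxFlux (fun t => Φ (fderiv ℝ g t)) J - boxFlux (fun t => Φ (fderiv ℝ h t)) J at h1
    rw [h0, sub_zero] at h1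
    rw [← h1]
    refine abs_boxFlux_le fun t ht => ?_
    have h2 : dist (fderiv ℝ g t) (fderiv ℝ h t) < δ := by
      rw [dist_comm]; exact (hd t).trans_lt (half_lt_self hδ)
    have h3 := H h2 (mem_image_of_mem _ ht)
    change ‖Φ (fderiv ℝ g t) - Φ (fderiv ℝ h t)‖ ≤ ε
    rw [← dist_eq_norm]
    exact le_of_lt h3
  have h4 : |boxFlux (fun t => Φ (fderiv ℝ g t)) J| ≤ 0 := by
    refine le_of_forall_pos_le_add fun ε hε => ?_
    obtain ⟨ε', hε', hlt⟩ := exists_pos_mul_lt hε C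
    linarith [key ε' hε']
  exact abs_nonpos_iff.1 h4

/-- A cutoff equal to 1 near the box reduces to compact support. -/
theorem boxFlux_pullback_const (η : E [⋀^Fin m]→L[ℝ] ℝ)
    {c : (Fin (m + 1) → ℝ) → E} {O : Set (Fin (m + 1) → ℝ)} (hO : IsOpen O)
    (hc : ContDiffOn ℝ 1 c O) {J : Box (Fin (m + 1))} (hJ : Box.Icc J ⊆ O) :
    boxFlux (fun t => formField m (η.compContinuousLinearMap (fderiv ℝ c t))) J = 0 := by
  obtain ⟨K, hK, hJK, hKO⟩ := exists_compact_between J.isCompact_Icc hO hJ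
  obtain ⟨χ, hχ1, hχ0, -⟩ := exists_contMDiffMap_one_nhds_of_subset_interior
    (n := 1) 𝓘(ℝ, Fin (m + 1) → ℝ) J.isCompact_Icc.isClosed hJK
  have hχ : ContDiff ℝ 1 χ := χ.contMDiff.contDiff
  let g : (Fin (m + 1) → ℝ) → E := fun t => χ t • c t
  have hg0 : ∀ t ∉ K, g t = 0 := fun t ht => by simp [g, hχ0 t ht]
  have hg : ContDiff ℝ 1 g := by
    refine contDiff_iff_contDiffAt.2 fun t => ?_
    by_cases ht : t ∈ O
    · exact hχ.contDiffAt.smul (hc.contDiffAt (hO.mem_nhds ht))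
    · have : g =ᶠ[𝓝 t] fun _ => 0 := by
        filter_upwards [hK.isClosed.isOpen_compl.mem_nhds fun h => ht (hKO h)] with s hs
        exact hg0 s hs
      exact contDiffAt_const.congr_of_eventuallyEq this
  have hgc : HasCompactSupport g := HasCompactSupport.intro hK hg0
  rw [← boxFlux_pullback_const_of_hasCompactSupport η hg hgc J]
  have heq : ∀ t ∈ Box.Icc J, fderiv ℝ c t = fderiv ℝ g t := by
    intro t ht
    refine Filter.EventuallyEq.fderiv_eq ?_
    filter_upwards [hχ1.filter_mono (nhds_le_nhdsSet ht)] with s hs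
    simp [g, hs]
  have hgcont : ContinuousOn
      (fun t => formField m (η.compContinuousLinearMap (fderiv ℝ g t))) (Box.Icc J) :=
    ((formField m).continuous.comp
      (ContinuousAlternatingMap.continuous_compContinuousLinearMap_uncurry.comp
      (continuous_const.prodMk (hg.continuous_fderiv one_ne_zero)))).continuousOn
  exact boxFlux_congr (hgcont.congr fun t ht => by rw [heq t ht]) hgcont
    fun t ht => by simp only [heq t ht]

end BoxIntegral

/-! ### Stokes' formula for one singular block. -/

namespace Stokes

open BoxIntegral BoxIntegral.IntegrationParams

theorem uniqueDiffOn_box {ι : Type*} [Fintype ι] (I : Box ι) : UniqueDiffOn ℝ (Box.Icc I) := by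
  rw [Box.Icc_eq_pi]
  exact UniqueDiffOn.univ_pi fun i => uniqueDiffOn_Icc (I.lower_lt_upper i)

theorem IsC1On.contDiffOn {E F : Type*} [NormedAddCommGroup E] [NormedSpace ℝ E]
    [NormedAddCommGroup F] [NormedSpace ℝ F] {f : E → F} {X : Set E} (h : IsC1On f X) :
    ContDiffOn ℝ 1 f X := by
  intro x hx
  obtain ⟨V, hV, hxV, G, hG, hfG⟩ := h x hx
  have hG' : ContDiffWithinAt ℝ 1 G (X ∩ V) x := (hG x hxV).mono inter_subset_right
  rw [← contDiffWithinAt_inter (hV.mem_nhds hxV)]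
  exact hG'.congr (fun y hy => hfG y ⟨hy.2, hy.1⟩) (hfG x ⟨hxV, hx⟩)

/-- The derivative of `Fin.insertNth i a`. -/
noncomputable def insertNthDeriv {k : ℕ} (i : Fin (k + 1)) :
    (Fin k → ℝ) →L[ℝ] Fin (k + 1) → ℝ :=
  ContinuousLinearMap.pi (i.insertNth 0 fun l => ContinuousLinearMap.proj l)

theorem hasFDerivAt_insertNth {k : ℕ} (i : Fin (k + 1)) (a : ℝ) (t : Fin k → ℝ) :
    HasFDerivAt (fun t : Fin k → ℝ => (i.insertNth a t : Fin (k + 1) → ℝ))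
      (insertNthDeriv i) t := by
  refine hasFDerivAt_pi.2 fun l => ?_
  refine Fin.succAboveCases i ?_ (fun l => ?_) l
  · simpa using hasFDerivAt_const a t
  · simpa using hasFDerivAt_apply l t

theorem insertNthDeriv_single {k : ℕ} (i : Fin (k + 1)) (l : Fin k) :
    insertNthDeriv i (Pi.single l 1) = Pi.single (i.succAbove l) 1 := by
  funext j
  refine Fin.succAboveCases i ?_ (fun j => ?_) j
  · simp [insertNthDeriv]
  · simp [insertNthDeriv, Pi.single_apply]

namespace SingularBlock

variable {n k : ℕ} {U : Set (EuclideanSpace ℝ (Fin n))}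

theorem contDiffOn (c : SingularBlock k U) : ContDiffOn ℝ 1 c.toFun (Box.Icc c.box) :=
  c.isC1On.contDiffOn

theorem continuousOn_pullback {m : ℕ} (c : SingularBlock k U) {ω : Form n m}
    (hω : ContinuousOn ω c.image) : ContinuousOn (c.pullback ω) (Box.Icc c.box) :=
  ContinuousAlternatingMap.continuous_compContinuousLinearMap_uncurry.comp_continuousOn
    ((hω.comp c.contDiffOn.continuousOn (mapsTo_image _ _)).prodMk
      (c.contDiffOn.continuousOn_fderivWithin (uniqueDiffOn_box _) le_rfl))

theorem continuousOn_coeff (c : SingularBlock k U) {ω : Form n k}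
    (hω : ContinuousOn ω c.image) : ContinuousOn (c.coeff ω) (Box.Icc c.box) :=
  (ContinuousAlternatingMap.apply ℝ (Fin k → ℝ) ℝ
    fun i => Pi.single i 1).continuous.comp_continuousOn (c.continuousOn_pullback hω)

theorem image_face_subset (c : SingularBlock (k + 1) U) (i : Fin (k + 1)) (j : Fin 2) :
    (c.face i j).image ⊆ c.image := by
  rintro _ ⟨t, ht, rfl⟩
  exact ⟨_, (insertNth_mem_Icc_iff c.box i j t).2 ht, rfl⟩

/-- The sign in `formField` squares to one; the rest is the chain rule, the face's coordinate
vectors being those of the block other than the `i`-th. -/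
theorem coeff_face (c : SingularBlock (k + 1) U) (ω : Form n k) (i : Fin (k + 1)) (j : Fin 2)
    {t : Fin k → ℝ} (ht : t ∈ Box.Icc (c.face i j).box) :
    (c.face i j).coeff ω t = (-1 : ℝ) ^ (i : ℕ) *
      formField k (c.pullback ω (i.insertNth (endpoint c.box i j) t)) i := by
  have hd : HasFDerivWithinAt (c.face i j).toFun
      (fderivWithin ℝ c.toFun (Box.Icc c.box) (i.insertNth (endpoint c.box i j) t) ∘L
        insertNthDeriv i) (Box.Icc (c.face i j).box) t :=
    HasFDerivWithinAt.comp t ((c.contDiffOn.differentiableOn one_ne_zero _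
      ((insertNth_mem_Icc_iff c.box i j t).2 ht)).hasFDerivWithinAt)
      (hasFDerivAt_insertNth i _ t).hasFDerivWithinAt
      fun s hs => (insertNth_mem_Icc_iff c.box i j s).2 hs
  rw [formField_apply, ← mul_assoc, ← mul_pow, neg_one_mul, neg_neg, one_pow, one_mul]
  unfold coeff pullback
  rw [hd.fderivWithin (uniqueDiffOn_box _ t ht)]
  simp only [ContinuousAlternatingMap.compContinuousLinearMap_apply]
  refine congrArg _ (funext fun l => ?_)
  simp [insertNthDeriv_single]

/-- The integral of a form over a singular block. -/
noncomputable def integral (c : SingularBlock k U) (ω : Form n k) : ℝ :=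
  BoxIntegral.integral c.box Riemann (c.coeff ω) BoxAdditiveMap.volume

theorem hasIntegral_integral (c : SingularBlock k U) {ω : Form n k}
    (hω : ContinuousOn ω c.image) : c.HasIntegral ω (c.integral ω) :=
  (integrable_of_continuousOn Riemann (c.continuousOn_coeff hω) volume).hasIntegral

theorem integral_face (c : SingularBlock (k + 1) U) {ω : Form n k}
    (hω : ContinuousOn ω c.image) (i : Fin (k + 1)) (j : Fin 2) :
    (c.face i j).integral ω = (-1 : ℝ) ^ (i : ℕ) * BoxIntegral.integral (c.box.face i) GP
      (fun t => formField k (c.pullback ω (i.insertNth (endpoint c.box i j) t)) i)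
      BoxAdditiveMap.volume := by
  have hF : ContinuousOn (fun t => formField k (c.pullback ω t)) (Box.Icc c.box) :=
    (formField k).continuous.comp_continuousOn (c.continuousOn_pullback hω)
  have h1 := ((integrable_face hF i (endpoint_mem c.box i j) GP).hasIntegral.smul
    ((-1 : ℝ) ^ (i : ℕ)))
  have h2 := ((c.face i j).hasIntegral_integral
    (hω.mono (c.image_face_subset i j))).mono (bot_le : GP ≤ Riemann)
  exact h2.unique ((hasIntegral_congr _ _ (fun t ht => c.coeff_face ω i j ht)
    (fun _ _ => rfl) _).2 h1)

/-- The sign from `integral_face` times the boundary sign is plus on upper faces and minus on lower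
ones. -/
theorem boxFlux_pullback_eq (c : SingularBlock (k + 1) U) {ω : Form n k}
    (hω : ContinuousOn ω c.image) :
    boxFlux (fun t => formField k (c.pullback ω t)) c.box =
      ∑ i : Fin (k + 1), ∑ j : Fin 2,
        (-1 : ℝ) ^ ((i : ℕ) + 1 + (j : ℕ)) * (c.face i j).integral ω := by
  unfold boxFlux
  refine Finset.sum_congr rfl fun i _ => ?_
  rw [Fin.sum_univ_two, c.integral_face hω, c.integral_face hω]
  have h : (-1 : ℝ) ^ (i : ℕ) * (-1 : ℝ) ^ (i : ℕ) = 1 := by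
    rw [← mul_pow]; simp
  have e0 : endpoint c.box i 0 = c.box.lower i := by simp [endpoint]
  have e1 : endpoint c.box i 1 = c.box.upper i := by simp [endpoint]
  rw [e0, e1]
  simp only [Fin.val_zero, Fin.val_one, pow_succ, add_zero]
  linear_combination (-(BoxIntegral.integral (c.box.face i) GP
      (fun t => formField k (c.pullback ω (i.insertNth (c.box.upper i) t)) i)
      BoxAdditiveMap.volume) + BoxIntegral.integral (c.box.face i) GP
      (fun t => formField k (c.pullback ω (i.insertNth (c.box.lower i) t)) i)
      BoxAdditiveMap.volume) * h

theorem sum_integral_face_eq (c : SingularBlock (k + 1) U) {ω : Form n k}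
    (hω : ContinuousOn ω c.image) (hd : ∀ x ∈ c.interiorImage, DifferentiableAt ℝ ω x) {y : ℝ}
    (hy : c.HasInteriorIntegral (extDeriv ω) y) :
    ∑ i : Fin (k + 1), ∑ j : Fin 2,
      (-1 : ℝ) ^ ((i : ℕ) + 1 + (j : ℕ)) * (c.face i j).integral ω = y := by
  obtain ⟨g, hg, hgy⟩ := hy
  rw [← c.boxFlux_pullback_eq hω]
  have hcont : ∀ {η : Form n k}, ContinuousOn η c.image →
      ContinuousOn (fun t => formField k (c.pullback η t)) (Box.Icc c.box) := fun h =>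
    (formField k).continuous.comp_continuousOn (c.continuousOn_pullback h)
  refine boxFlux_eq_of_hasIntegral (hcont hω) hgy fun p hp => ?_
  have hpI : p ∈ Box.Icc c.box := Box.Ioo_subset_Icc _ hp
  have hopen : IsOpen (Box.Ioo c.box) := isOpen_set_pi finite_univ fun _ _ => isOpen_Ioo
  set D := fderivWithin ℝ c.toFun (Box.Icc c.box) with hD
  have hcp : HasFDerivWithinAt c.toFun (D p) (Box.Icc c.box) p :=
    (c.contDiffOn.differentiableOn one_ne_zero p hpI).hasFDerivWithinAt
  have hωp := (hd _ ⟨p, hp, rfl⟩).hasFDerivAt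
  -- The form frozen at `c p`.
  let η : Form n k := fun _ => ω (c.toFun p)
  let H' := formField k ∘L ContinuousAlternatingMap.compContinuousLinearMapCLM (D p) ∘L
    fderiv ℝ ω (c.toFun p) ∘L D p
  refine ⟨fun t => formField k (c.pullback (ω - η) t), H',
    hcont (hω.sub continuousOn_const), fun J hJ => ?_, ?_, ?_⟩
  · have hJI : Box.Icc J ⊆ Box.Icc c.box := hJ.trans (Box.Ioo_subset_Icc _)
    have hDc : ∀ t ∈ Box.Icc J, D t = fderiv ℝ c.toFun t := fun t ht =>
      fderivWithin_of_mem_nhds (mem_of_superset (hopen.mem_nhds (hJ ht)) (Box.Ioo_subset_Icc _))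
    -- Over `J` the difference of the two fields comes from the pullback of the constant form.
    have h0 := boxFlux_pullback_const (ω (c.toFun p)) hopen
      (c.contDiffOn.mono (Box.Ioo_subset_Icc _)) hJ
    have heq : EqOn ((fun t => formField k (c.pullback ω t)) -
        fun t => formField k (c.pullback (ω - η) t)) (fun t => formField k
        ((ω (c.toFun p)).compContinuousLinearMap (fderiv ℝ c.toFun t))) (Box.Icc J) := by
      intro t ht
      change formField k (c.pullback ω t) - formField k (c.pullback (ω - η) t) =
        formField k ((ω (c.toFun p)).compContinuousLinearMap (fderiv ℝ c.toFun t))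
      rw [← hDc t ht, ← map_sub]
      congr 1
      ext v
      simp [pullback, η, hD]
    have hc1 := ((hcont hω).sub (hcont (hω.sub (continuousOn_const (c := ω (c.toFun p)))))).mono hJI
    rw [← h0]
    exact boxFlux_congr hc1 (hc1.congr fun t ht => (heq ht).symm) heq
  · have hu : HasFDerivWithinAt (fun t => (ω - η) (c.toFun t))
        (fderiv ℝ ω (c.toFun p) ∘L D p) (Box.Icc c.box) p :=
      (hωp.comp_hasFDerivWithinAt p hcp).sub_const _
    have := ContinuousAlternatingMap.hasFDerivWithinAt_compContinuousLinearMap_of_eq_zero hu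
      (by simp [η]) (c.contDiffOn.continuousOn_fderivWithin (uniqueDiffOn_box _) le_rfl p hpI)
    exact (formField k).hasFDerivAt.comp_hasFDerivWithinAt p this
  -- `D p` acts on the direction of differentiation and on the `k` arguments of the form, so
  -- alternation yields the pullback of dω at `p`.
  · rw [sum_formField_comp_apply, hg p hp]
    unfold coeff pullback extDeriv
    rw [ContinuousAlternatingMap.compContinuousLinearMap_apply,
      ContinuousAlternatingMap.alternatizeUncurryFin_apply,
      ContinuousAlternatingMap.alternatizeUncurryFin_apply]
    rfl

end SingularBlock

/-! ### Passage to chains. -/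

namespace Chain

variable {n k : ℕ} {U : Set (EuclideanSpace ℝ (Fin n))}

/-- The sum of the integrals over the blocks of a chain. -/
noncomputable def integral (ω : Form n k) : Chain k U →+ ℝ :=
  Finsupp.liftAddHom fun s => (AddMonoidHom.mulRight (s.integral ω)).comp
    (Int.castAddHom ℝ)

theorem integral_apply (ω : Form n k) (c : Chain k U) :
    integral ω c = c.sum fun s m => (m : ℝ) * s.integral ω := rfl

theorem integral_single (ω : Form n k) (s : SingularBlock k U) (m : ℤ) :
    integral ω (Finsupp.single s m) = m * s.integral ω := by
  simp [integral_apply]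

theorem hasIntegral_integral {ω : Form n k} {c : Chain k U}
    (h : ∀ s ∈ c.support, ContinuousOn ω s.image) : c.HasIntegral ω (integral ω c) :=
  ⟨fun s => s.integral ω, fun s hs => s.hasIntegral_integral (h s hs), rfl⟩

end Chain

namespace SingularBlock

variable {n k : ℕ} {U : Set (EuclideanSpace ℝ (Fin n))}

/-- Cancellation only shrinks the support, so each block in it is a face. -/
theorem continuousOn_of_mem_support_boundary {c : SingularBlock (k + 1) U} {ω : Form n k}
    (hω : ContinuousOn ω c.image) {s : SingularBlock k U} (hs : s ∈ c.boundary.support) :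
    ContinuousOn ω s.image := by
  classical
  obtain ⟨i, -, hi⟩ := Finset.mem_biUnion.1 (Finsupp.support_finsetSum hs)
  obtain ⟨j, -, hj⟩ := Finset.mem_biUnion.1 (Finsupp.support_finsetSum hi)
  obtain rfl := Finset.mem_singleton.1 (Finsupp.support_single_subset hj)
  exact hω.mono (c.image_face_subset i j)

/-- Additivity of `Chain.integral` takes care of faces that coincide or cancel. -/
theorem integral_boundary {c : SingularBlock (k + 1) U} {ω : Form n k}
    (hω : ContinuousOn ω c.image) (hd : ∀ x ∈ c.interiorImage, DifferentiableAt ℝ ω x) {y : ℝ}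
    (hy : c.HasInteriorIntegral (extDeriv ω) y) : Chain.integral ω c.boundary = y := by
  rw [← c.sum_integral_face_eq hω hd hy, boundary, map_sum]
  refine Finset.sum_congr rfl fun i _ => ?_
  rw [map_sum]
  refine Finset.sum_congr rfl fun j _ => ?_
  rw [Chain.integral_single]
  push_cast
  rfl

end SingularBlock

end Stokes

end

theorem theorem2 {n k : ℕ} (U : Set (EuclideanSpace ℝ (Fin n))) (hU : IsOpen U)
    (ω : Stokes.Form n k) :
    (∀ c : Stokes.SingularBlock (k + 1) U,
      ContinuousOn ω c.image →
      (∀ x ∈ c.interiorImage, DifferentiableAt ℝ ω x) →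
      ∀ y : ℝ, c.HasInteriorIntegral (extDeriv ω) y →
        Stokes.Chain.HasIntegral c.boundary ω y) ∧
    (∀ c : Stokes.Chain (k + 1) U,
      (∀ s ∈ c.support, ContinuousOn ω s.image) →
      (∀ s ∈ c.support, ∀ x ∈ s.interiorImage, DifferentiableAt ℝ ω x) →
      ∀ y : ℝ, Stokes.Chain.HasInteriorIntegral c (extDeriv ω) y →
        Stokes.Chain.HasIntegral (Stokes.Chain.boundary c) ω y) := by
  classical
  refine ⟨fun c hω hd y hy => ?_, fun c hω hd y hy => ?_⟩
  · rw [← Stokes.SingularBlock.integral_boundary hω hd hy]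
    exact Stokes.Chain.hasIntegral_integral fun s hs =>
      Stokes.SingularBlock.continuousOn_of_mem_support_boundary hω hs
  · obtain ⟨v, hv, rfl⟩ := hy
    have h : Stokes.Chain.integral ω (Stokes.Chain.boundary c) =
        c.sum fun s m => (m : ℝ) * v s := by
      rw [Stokes.Chain.boundary, Finsupp.sum, Finsupp.sum, map_sum]
      refine Finset.sum_congr rfl fun s hs => ?_
      rw [map_zsmul, Stokes.SingularBlock.integral_boundary (hω s hs) (hd s hs) (hv s hs),
        zsmul_eq_mul]
    rw [← h]
    refine Stokes.Chain.hasIntegral_integral fun s hs => ?_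
    obtain ⟨b, hb, hsb⟩ := Finset.mem_biUnion.1 (Finsupp.support_finsetSum hs)
    exact Stokes.SingularBlock.continuousOn_of_mem_support_boundary (hω b hb)
      (Finsupp.support_smul hsb)
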